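/- Fix integers $d\ge 1$ and $T\ge 3$ and let $\mathbb B=\{w\in\mathbb R^d:\|w\|_2\le 1\}$. An instance consists of vectors $s,b\in\mathbb B$, unknown to the learner, and contexts $x_1,x_2,\dots\in\mathbb B$. In round $t=1,\dots,T$ the learner observes $x_t$ and posts a price $p_t$ to the seller and $q_t$ to the buyer; the valuations are $s_t=\langle s,x_t\rangle$ and $b_t=\langle b,x_t\rangle$, a trade happens iff $s_t\le p_t$ and $q_t\le b_t$, and the learner then observes only whether it happened (one-bit feedback). Let $\mathrm{Profit}_t=q_t-p_t$ if the trade happens and $0$ otherwise. The regret is $\sum_{t=1}^T\max\{b_t-s_t,0\}-\sum_{t=1}^T\mathrm{Profit}_t$, and the total negative profit is $\sum_{t=1}^T\max\{0,-\mathrm{Profit}_t\}$. For $K\subseteq\mathbb R^d$ and $x\in\mathbb R^d$ let $\mathrm{proj}(K,x)=\{\langle v,x\rangle: v\in K\}$, and let its width be its maximum minus its minimum. The following algorithms keep confidence regions $S_t,B_t$ with $S_1=B_1=\mathbb B$. Write $\mathrm{proj}(S_t,x_t)=[\underline s_t,\overline s_t]$ and $\mathrm{proj}(B_t,x_t)=[\underline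 b_t,\overline b_t]$, with widths $w^S_t,w^B_t$, and let $z_i=2^{-3\cdot 2^i}/(16d)$. Let $i_t$ be the largest integer $i\ge 0$ with $\max\{w^S_t,w^B_t\}\le 2^{-2^i}$, and $i_t=0$ if there is none. Consider the following pricing rule. 1. If $\max\{w^S_t,w^B_t\}\le 1/T$, then $p_t=\overline s_t$ and $q_t=\max\{p_t,\underline b_t\}$. 2. Otherwise, if $w^S_t\ge w^B_t$ (the seller dominates), then the seller gets an unbalanced price $p_t=m+z_{i_t}$, where $m$ satisfies $\mathrm{vol}\{v\in S_t+z_{i_t}\mathbb B:\langle v,x_t\rangle\ge m\}=2^{-2^{i_t-1}}\,\mathrm{vol}(S_t+z_{i_t}\mathbb B)$. If the two projections intersect, the buyer gets the uncapped safe price $q_t=\underline b_t$; if they are disjoint, $q_t=\max\{p_t,\underline b_t\}$. 3. Otherwise (the buyer dominates) the buyer gets an unbalanced price $q_t=m-z_{i_t}$, where $m$ satisfies $\mathrm{vol}\{v\in B_t+z_{i_t}\mathbb B:\langle v,x_t\rangle\le m\}=2^{-2^{i_t-1}}\,\mathrm{vol}(B_t+z_{i_t}\mathbb B)$. If the two projections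 intersect, the seller gets the uncapped safe price $p_t=\overline s_t$; if they are disjoint, $p_t=\min\{q_t,\overline s_t\}$. After the round, if the buyer's price was safe ($q_t\le\underline b_t$), then $S_{t+1}$ is $\{v\in S_t:\langle v,x_t\rangle\le p_t\}$ if the trade happened and $\{v\in S_t:\langle v,x_t\rangle\ge p_t\}$ if not; if the seller's price was safe ($p_t\ge\overline s_t$), then $B_{t+1}$ is $\{v\in B_t:\langle v,x_t\rangle\ge q_t\}$ if the trade happened and $\{v\in B_t:\langle v,x_t\rangle\le q_t\}$ if not. A region is unchanged when the other agent's price was not safe. **Theorem.** There is an absolute constant $C>0$ such that for all $d\ge1$ and $T\ge3$ there is a deterministic algorithm for the one-bit feedback model (it may depend on $d$ and $T$) that on every instance posts its prices in rounds $1,\dots,T$ according to the rule above, has regret at most $C\,(d\log\log T+d\log(d+1))$, and has total negative profit at most $C\,d\log(d+1)$. (For $d\ge 2$, $d\log(d+1)$ is of the order of $d\log d$.) -/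

import Mathlib

open scoped Pointwise

noncomputable section

namespace BilateralTrade

/-- The space of contexts and weight vectors, with the Euclidean norm. -/
abbrev Vec (d : ℕ) : Type := EuclideanSpace ℝ (Fin d)

/-- The Euclidean unit ball. -/
def unitBall (d : ℕ) : Set (Vec d) := Metric.closedBall 0 1

/-- A deterministic algorithm for the one-bit feedback model: from the past rounds, each recorded as
(context, whether a trade happened) with the most recent one first, and from the current context, it
computes the price for the seller and the price for the buyer. -/
abbrev OneBitAlgorithm (d : ℕ) : Type := List (Vec d × Bool) → Vec d → ℝ × ℝ

/-- The trade happens iff the seller (valuation `⟪s, x⟫`) accepts `p` and the buyer (valuation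
`⟪b, x⟫`) accepts `q`. This is the bit of feedback. -/
def tradeBit {d : ℕ} (s b x : Vec d) (p q : ℝ) : Bool :=
  decide (inner ℝ s x ≤ p ∧ q ≤ inner ℝ b x)

/-- The profit of posting `p` to the seller and `q` to the buyer. -/
def profit {d : ℕ} (s b x : Vec d) (p q : ℝ) : ℝ :=
  if tradeBit s b x p q = true then q - p else 0

/-- The information held by the learner before round `t` (rounds are numbered from `0`). -/
def history {d : ℕ} (A : OneBitAlgorithm d) (s b : Vec d) (x : ℕ → Vec d) :
    ℕ → List (Vec d × Bool)
  | 0 => []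
  | t + 1 =>
    (x t, tradeBit s b (x t) (A (history A s b x t) (x t)).1 (A (history A s b x t) (x t)).2)
      :: history A s b x t

/-- The price posted to the seller in round `t`. -/
def sellerPrice {d : ℕ} (A : OneBitAlgorithm d) (s b : Vec d) (x : ℕ → Vec d) (t : ℕ) : ℝ :=
  (A (history A s b x t) (x t)).1

/-- The price posted to the buyer in round `t`. -/
def buyerPrice {d : ℕ} (A : OneBitAlgorithm d) (s b : Vec d) (x : ℕ → Vec d) (t : ℕ) : ℝ :=
  (A (history A s b x t) (x t)).2

/-- The profit collected in round `t`. -/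
def roundProfit {d : ℕ} (A : OneBitAlgorithm d) (s b : Vec d) (x : ℕ → Vec d) (t : ℕ) : ℝ :=
  profit s b (x t) (sellerPrice A s b x t) (buyerPrice A s b x t)

/-- The profit regret over `T` rounds, against the best omniscient dynamic prices. -/
def regret {d : ℕ} (A : OneBitAlgorithm d) (T : ℕ) (s b : Vec d) (x : ℕ → Vec d) : ℝ :=
  (∑ t ∈ Finset.range T, max (inner ℝ b (x t) - inner ℝ s (x t)) 0)
    - ∑ t ∈ Finset.range T, roundProfit A s b x t

/-- The total negative profit over `T` rounds. -/
def negativeProfit {d : ℕ} (A : OneBitAlgorithm d) (T : ℕ) (s b : Vec d) (x : ℕ → Vec d) : ℝ :=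
  ∑ t ∈ Finset.range T, max 0 (-roundProfit A s b x t)

/-- The projection `{⟪v, x⟫ | v ∈ K}` of `K` along `x`. -/
def proj {d : ℕ} (K : Set (Vec d)) (x : Vec d) : Set ℝ := (fun v => inner ℝ v x) '' K

/-- The smallest value in the projection. -/
def lo {d : ℕ} (K : Set (Vec d)) (x : Vec d) : ℝ := sInf (proj K x)

/-- The largest value in the projection. -/
def hi {d : ℕ} (K : Set (Vec d)) (x : Vec d) : ℝ := sSup (proj K x)

/-- The width of `K` along `x`. -/
def width {d : ℕ} (K : Set (Vec d)) (x : Vec d) : ℝ := hi K x - lo K x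

/-- The two confidence regions. -/
structure Regions (d : ℕ) where
  seller : Set (Vec d)
  buyer : Set (Vec d)

/-- Update of the confidence regions after prices `p`, `q` were posted under context `x` and the bit
`trade` was observed. A region is cut only if the feedback is unambiguous for that agent, i.e. if
the price of the other agent is safe (sure to be accepted); then the bit says whether the agent
accepted its own price. -/
def Regions.update {d : ℕ} (R : Regions d) (x : Vec d) (p q : ℝ) (trade : Bool) : Regions d where
  seller :=
    if q ≤ lo R.buyer x then
      (if trade = true then {v ∈ R.seller | inner ℝ v x ≤ p} else {v ∈ R.seller | p ≤ inner ℝ v x})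
    else R.seller
  buyer :=
    if hi R.seller x ≤ p then
      (if trade = true then {v ∈ R.buyer | q ≤ inner ℝ v x} else {v ∈ R.buyer | inner ℝ v x ≤ q})
    else R.buyer

/-- The confidence regions before round `t`; they depend only on what the learner has seen. -/
def regions {d : ℕ} (A : OneBitAlgorithm d) (s b : Vec d) (x : ℕ → Vec d) : ℕ → Regions d
  | 0 => ⟨unitBall d, unitBall d⟩
  | t + 1 =>
    (regions A s b x t).update (x t) (sellerPrice A s b x t) (buyerPrice A s b x t)
      (tradeBit s b (x t) (sellerPrice A s b x t) (buyerPrice A s b x t))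

/-- The scale `2 ^ (-3 * 2 ^ i) / (16 * d)`. -/
def scale (d i : ℕ) : ℝ := (1 / 2 : ℝ) ^ (3 * 2 ^ i) / (16 * d)

/-- For `w > 0`, the largest `i : ℕ` with `w ≤ 2 ^ (-2 ^ i)`; it is `0` if there is none, that is if
`w > 1 / 2` (the supremum of the empty set of natural numbers is `0`). -/
def index (w : ℝ) : ℕ := sSup {i : ℕ | w ≤ (1 / 2 : ℝ) ^ (2 ^ i)}

/-- The fraction `2 ^ (-2 ^ (i - 1))`, where the exponent `i - 1` may be `-1`. -/
def fraction (i : ℕ) : ℝ := (1 / 2 : ℝ) ^ ((2 : ℝ) ^ ((i : ℝ) - 1))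

/-- The Minkowski sum of `K` and the ball of radius `scale d i`. -/
def fatten {d : ℕ} (K : Set (Vec d)) (i : ℕ) : Set (Vec d) := K + scale d i • unitBall d

/-- `p` is an unbalanced price for a seller with confidence region `S`: `p = m + z_i`, where the part
of `S + z_i 𝔹` above level `m` has a fraction `2 ^ (-2 ^ (i - 1))` of its volume. -/
def IsUnbalancedSellerPrice {d : ℕ} (S : Set (Vec d)) (x : Vec d) (i : ℕ) (p : ℝ) : Prop :=
  ∃ m : ℝ, MeasureTheory.volume {v ∈ fatten S i | m ≤ inner ℝ v x}
      = ENNReal.ofReal (fraction i) * MeasureTheory.volume (fatten S i)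
    ∧ p = m + scale d i

/-- `q` is an unbalanced price for a buyer with confidence region `B`: `q = m - z_i`, where the part
of `B + z_i 𝔹` below level `m` has a fraction `2 ^ (-2 ^ (i - 1))` of its volume. -/
def IsUnbalancedBuyerPrice {d : ℕ} (B : Set (Vec d)) (x : Vec d) (i : ℕ) (q : ℝ) : Prop :=
  ∃ m : ℝ, MeasureTheory.volume {v ∈ fatten B i | inner ℝ v x ≤ m}
      = ENNReal.ofReal (fraction i) * MeasureTheory.volume (fatten B i)
    ∧ q = m - scale d i

/-- The pricing rule. If both widths are at most `1 / T`, both agents get their safe price (the one of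
the buyer being raised to that of the seller if needed). Otherwise the agent with the larger width
(the dominating one) gets an unbalanced price and the other one a safe price, which is left uncapped
when the two projections intersect, and is capped by budget balance when they are disjoint. -/
def PostsUnbalancedSafe {d : ℕ} (T : ℕ) (R : Regions d) (x : Vec d) (p q : ℝ) : Prop :=
  let wS := width R.seller x
  let wB := width R.buyer x
  (max wS wB ≤ 1 / (T : ℝ) → p = hi R.seller x ∧ q = max p (lo R.buyer x)) ∧
  (1 / (T : ℝ) < max wS wB → wB ≤ wS →
    IsUnbalancedSellerPrice R.seller x (index wS) p ∧
    (¬ Disjoint (proj R.seller x) (proj R.buyer x) → q = lo R.buyer x) ∧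
    (Disjoint (proj R.seller x) (proj R.buyer x) → q = max p (lo R.buyer x))) ∧
  (1 / (T : ℝ) < max wS wB → wS < wB →
    IsUnbalancedBuyerPrice R.buyer x (index wB) q ∧
    (¬ Disjoint (proj R.seller x) (proj R.buyer x) → p = hi R.seller x) ∧
    (Disjoint (proj R.seller x) (proj R.buyer x) → p = min q (hi R.seller x)))

end BilateralTrade

end

/-! Write `f = fraction i`. A dominating width `w` of level `i` satisfies `f ^ 4 < w ≤ 4 * f ^ 2`,
and `scale d i = f ^ 6 / (16 * d)`. Each region has one potential per level, the log-volume of its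
fattening at that scale. Potentials only decrease, and the fattening always contains a ball of
radius `scale d i`, so the total decrease at level `i` is at most `d * (log (d + 1) + 6 * 2 ^ i)`
(`potential_sub_le`).

A round at level `i` is paid for by the potential of the dominating region at that level. The safe
price of the other agent makes the bit reveal the answer to the unbalanced price. Acceptance costs
at most `2 * w ≤ 8 * f ^ 2` and lowers the potential by at least `f / 2`, because slabs of thickness
`2 * scale d i` have little volume (`volume_slab_le`). Rejection costs at most `2` in regret,
nothing in negative profit, and lowers the potential by `2 ^ i / 2 * log 2`
(`round_le_of_seller_dominates`). Reflection gives the same for the buyer.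

Acceptances thus cost `O(f)` per unit of potential; as `f` decays doubly exponentially, the sum over
all levels is `O(d log (d + 1))`, which bounds the negative profit. Rejections cost `O(2 ^ (-i))`
per unit, hence `O(d)` per level beyond a geometric series, and only `O(log log T)` levels occur
while a width exceeds `1 / T`. Narrow rounds cost `O(1 / T)` each. -/

namespace BilateralTrade

/-! ### Arithmetic of levels, fractions and scales -/

theorem fraction_pos (i : ℕ) : 0 < fraction i := by
  unfold fraction; positivity

theorem log_fraction (i : ℕ) : Real.log (fraction i) = -(2 ^ i / 2 * Real.log 2) := by
  unfold fraction
  rw [Real.log_rpow (by norm_num), Real.rpow_sub_one (by norm_num), Real.rpow_natCast, one_div,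
    Real.log_inv]
  ring

theorem fraction_lt_one (i : ℕ) : fraction i < 1 := by
  rw [← Real.log_neg_iff (fraction_pos i), log_fraction]
  have := Real.log_pos (one_lt_two)
  have : (0 : ℝ) < 2 ^ i / 2 * Real.log 2 := by positivity
  linarith

theorem fraction_sq (i : ℕ) : fraction i ^ 2 = (1 / 2 : ℝ) ^ (2 ^ i) := by
  apply Real.log_injOn_pos
  · exact pow_pos (fraction_pos i) 2
  · exact Set.mem_Ioi.2 (by positivity)
  · rw [Real.log_pow, log_fraction, Real.log_pow, one_div, Real.log_inv]
    push_cast; ring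

theorem scale_eq (d i : ℕ) : scale d i = fraction i ^ 6 / (16 * d) := by
  rw [scale, mul_comm 3, pow_mul, ← fraction_sq, ← pow_mul]

theorem scale_pos {d : ℕ} (hd : 1 ≤ d) (i : ℕ) : 0 < scale d i := by
  have : (0 : ℝ) < d := by exact_mod_cast hd
  unfold scale; positivity

/-- The fraction decays doubly exponentially. -/
theorem fraction_mul_le (i : ℕ) : fraction i * 2 ^ i ≤ 17 * (1 / 2) ^ i := by
  have h2 := Real.log_two_gt_d9
  have hy : (0 : ℝ) < 2 ^ i := by positivity
  have hf : fraction i = (Real.exp (2 ^ i / 2 * Real.log 2))⁻¹ := by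
    rw [← Real.exp_neg, ← log_fraction, Real.exp_log (fraction_pos i)]
  -- The quadratic term of the exponential is `(2 ^ i) ^ 2 * log 2 ^ 2 / 8`, at least `0.06 * (2 ^
  -- i) ^ 2`, and `17 * 0.06 > 1`.
  have hq := Real.quadratic_le_exp_of_nonneg (x := 2 ^ i / 2 * Real.log 2) (by positivity)
  have hsq : (0.48 : ℝ) ≤ Real.log 2 ^ 2 := by nlinarith
  have hbig : ((2 : ℝ) ^ i) ^ 2 ≤ 17 * Real.exp (2 ^ i / 2 * Real.log 2) := by
    have h1 : (0.48 : ℝ) * (2 ^ i) ^ 2 ≤ Real.log 2 ^ 2 * (2 ^ i) ^ 2 := by gcongr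
    have h3 : 0 ≤ (2 : ℝ) ^ i / 2 * Real.log 2 := by positivity
    nlinarith
  rw [hf, one_div, inv_pow, inv_mul_eq_div, ← div_eq_mul_inv, div_le_div_iff₀ (by positivity) hy]
  nlinarith

theorem bddAbove_index {w : ℝ} (hw : 0 < w) : BddAbove {i : ℕ | w ≤ (1 / 2 : ℝ) ^ (2 ^ i)} := by
  obtain ⟨n, hn⟩ := exists_pow_lt_of_lt_one hw (by norm_num : (1 / 2 : ℝ) < 1)
  refine ⟨n, fun i hi => ?_⟩
  by_contra! h
  have : (1 / 2 : ℝ) ^ (2 ^ i) ≤ (1 / 2 : ℝ) ^ n :=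
    pow_le_pow_of_le_one (by norm_num) (by norm_num) (h.le.trans (Nat.lt_two_pow_self).le)
  exact absurd (hi.trans this) (not_le.2 hn)

/-- Maximality: `index w + 1` fails the defining inequality, whose right side there is `fraction
(index w) ^ 4`. Positivity of `w` bounds the set, so the supremum is genuine. -/
theorem lt_of_index {w : ℝ} (hw : 0 < w) : fraction (index w) ^ 4 < w := by
  by_contra! h
  have hmem : index w + 1 ∈ {i : ℕ | w ≤ (1 / 2 : ℝ) ^ (2 ^ i)} := by
    refine h.trans_eq ?_
    rw [pow_succ 2, pow_mul, ← fraction_sq, ← pow_mul]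
  have := le_csSup (bddAbove_index hw) hmem
  exact absurd this (by simp [index])

theorem index_spec {w : ℝ} (hw : 0 < w) :
    w ≤ (1 / 2 : ℝ) ^ (2 ^ index w) ∨ index w = 0 := by
  rcases Set.eq_empty_or_nonempty {i : ℕ | w ≤ (1 / 2 : ℝ) ^ (2 ^ i)} with h | h
  · right; rw [index, h]; simp
  · left; exact Nat.sSup_mem h (bddAbove_index hw)

/-- The factor `4` covers widths in `(1 / 2, 2]`, which get the default index `0`: there `4 *
fraction 0 ^ 2 = 2`. -/
theorem le_of_index {w : ℝ} (hw : 0 < w) (hw2 : w ≤ 2) : w ≤ 4 * fraction (index w) ^ 2 := by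
  rw [fraction_sq]
  rcases index_spec hw with h | h
  · have : (0 : ℝ) < (1 / 2 : ℝ) ^ (2 ^ index w) := by positivity
    linarith
  · rw [h]; norm_num; exact hw2

/-- A bound on the number of levels that occur while some width exceeds `1 / T`. -/
noncomputable def levels (T : ℕ) : ℕ := ⌊Real.log (Real.log T) / Real.log 2⌋₊ + 2

theorem index_lt_levels {T : ℕ} (hT : 3 ≤ T) {w : ℝ} (hw : 1 / (T : ℝ) < w) :
    index w < levels T := by
  have hT0 : (0 : ℝ) < T := by positivity
  rcases index_spec ((by positivity : (0 : ℝ) < 1 / T).trans hw) with h | h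
  · have h2 := Real.log_two_gt_d9
    have h1 := hw.trans_le h
    have h3 := Real.log_lt_log (by positivity) h1
    rw [Real.log_pow, one_div, one_div, Real.log_inv, Real.log_inv] at h3
    push_cast at h3
    have h4 : (2 : ℝ) ^ index w * Real.log 2 < Real.log T := by linarith
    have h5 := Real.log_lt_log (by positivity) h4
    rw [Real.log_mul (by positivity) (by positivity), Real.log_pow] at h5
    -- Taking logarithms twice leaves `log (log 2)`, which is negative; bounding it by `-log 2`
    -- costs one extra level.
    have h6 : -Real.log 2 ≤ Real.log (Real.log 2) := by
      rw [← Real.log_inv]; exact Real.log_le_log (by norm_num) (by norm_num; linarith)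
    have h7 : (index w : ℝ) - 1 < Real.log (Real.log T) / Real.log 2 := by
      rw [lt_div_iff₀ (by linarith)]; linarith
    have h8 := Nat.lt_floor_add_one (Real.log (Real.log T) / Real.log 2)
    have h9 : (index w : ℝ) < levels T := by rw [levels]; push_cast; linarith
    exact_mod_cast h9
  · rw [h, levels]; omega

theorem log_log_pos {T : ℕ} (hT : 3 ≤ T) : 0 < Real.log (Real.log T) := by
  have h3 : (3 : ℝ) ≤ T := by exact_mod_cast hT
  refine Real.log_pos ?_
  rw [Real.lt_log_iff_exp_lt (by linarith)]
  have := Real.exp_one_lt_d9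
  linarith

theorem levels_le {T : ℕ} (hT : 3 ≤ T) : (levels T : ℝ) ≤ 2 * Real.log (Real.log T) + 2 := by
  have h2 := Real.log_two_gt_d9
  have hl := log_log_pos hT
  have h1 := Nat.floor_le (a := Real.log (Real.log T) / Real.log 2) (by positivity)
  have h3 : Real.log (Real.log T) / Real.log 2 ≤ 2 * Real.log (Real.log T) := by
    rw [div_le_iff₀ (by linarith)]; nlinarith
  rw [levels]; push_cast; linarith

/-- The left side is at most `log (2 / scale d i) = log d + (5 + 3 * 2 ^ i) * log 2`, and `8 * log 2
< 6`. -/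
theorem log_scale_le {d : ℕ} (hd : 1 ≤ d) (i : ℕ) :
    Real.log ((1 + scale d i) / scale d i) ≤ Real.log (d + 1) + 6 * 2 ^ i := by
  have hd' : (1 : ℝ) ≤ d := by exact_mod_cast hd
  have hz := scale_pos hd i
  have hz1 : scale d i ≤ 1 := by
    rw [scale_eq, div_le_one (by positivity)]
    have := pow_le_one₀ (n := 6) (fraction_pos i).le (fraction_lt_one i).le
    linarith
  have hl2 := Real.log_two_lt_d9
  have h1 : (1 + scale d i) / scale d i ≤ 2 / scale d i := by gcongr; linarith
  have h2 : Real.log (2 / scale d i) = 5 * Real.log 2 + Real.log d + 3 * 2 ^ i * Real.log 2 := by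
    rw [scale, Real.log_div (by norm_num) (by positivity),
      Real.log_div (by positivity) (by positivity), Real.log_mul (by norm_num) (by positivity),
      Real.log_pow, one_div, Real.log_inv, show (16 : ℝ) = 2 ^ 4 by norm_num, Real.log_pow]
    push_cast; ring
  have h3 : Real.log d ≤ Real.log (d + 1) := Real.log_le_log (by linarith) (by linarith)
  have h4 : (1 : ℝ) ≤ 2 ^ i := one_le_pow₀ (by norm_num)
  have h5 := Real.log_le_log (by positivity) h1
  rw [h2] at h5
  nlinarith [Real.log_two_gt_d9]

/-! ### Volumes of slabs and caps of convex bodies -/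

open MeasureTheory

variable {d : ℕ}

theorem volume_hyperplane {x : Vec d} (hx : x ≠ 0) (c : ℝ) :
    volume {v : Vec d | inner ℝ v x = c} = 0 := by
  rcases Set.eq_empty_or_nonempty {v : Vec d | inner ℝ v x = c} with h | ⟨u, hu⟩
  · rw [h, measure_empty]
  · have hs : {v : Vec d | inner ℝ v x = c} =
        (AffineSubspace.mk' u (ℝ ∙ x)ᗮ : AffineSubspace ℝ (Vec d)) := by
      ext v
      rw [SetLike.mem_coe, AffineSubspace.mem_mk', Submodule.mem_orthogonal_singleton_iff_inner_left,
        vsub_eq_sub, inner_sub_left, show inner ℝ u x = c from hu, sub_eq_zero]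
      rfl
    rw [hs]
    refine Measure.addHaar_affineSubspace _ _ fun htop => hx ?_
    have h := congrArg AffineSubspace.direction htop
    rw [AffineSubspace.direction_mk', AffineSubspace.direction_top,
      Submodule.orthogonal_eq_top_iff, Submodule.span_singleton_eq_bot] at h
    exact h

theorem measurableSet_cap {K : Set (Vec d)} (hK : IsCompact K) (x : Vec d) (m : ℝ) :
    MeasurableSet {v ∈ K | m ≤ inner ℝ v x} :=
  hK.measurableSet.inter (measurableSet_le measurable_const
    (by fun_prop : Measurable fun v : Vec d => inner ℝ v x))

theorem measure_subset_ne_top {K L : Set (Vec d)} (hK : IsCompact K) (hL : L ⊆ K) :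
    volume L ≠ ⊤ := ne_top_of_le_ne_top hK.measure_lt_top.ne (measure_mono hL)

/-- A thin slab far below a point of a convex body is a small part of its volume: the homothety at
this point moves the part of the body above the slab's bottom to the part above the slab's top. -/
theorem volume_slab_le_of_apex {K : Set (Vec d)} (hK : IsCompact K) (hc : Convex ℝ K) {x u : Vec d}
    (hu : u ∈ K) (hx : x ≠ 0) {a a' : ℝ} (haa : a ≤ a') (ha' : a' ≤ inner ℝ u x)
    (ha : a < inner ℝ u x) :
    volume.real {v ∈ K | a ≤ inner ℝ v x ∧ inner ℝ v x ≤ a'} ≤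
      d * (a' - a) / (inner ℝ u x - a) * volume.real K := by
  set H := inner ℝ u x
  have hpos : 0 < H - a := by linarith
  set r := (H - a') / (H - a) with hr
  have hr0 : 0 ≤ r := div_nonneg (by linarith) hpos.le
  have hr1 : r ≤ 1 := by rw [hr, div_le_one hpos]; linarith
  set P := {v ∈ K | a ≤ inner ℝ v x} with hP
  set Q := {v ∈ K | a' ≤ inner ℝ v x} with hQ
  have himg : AffineMap.homothety u r '' P ⊆ Q := by
    rintro _ ⟨v, ⟨hvK, hva⟩, rfl⟩
    constructor
    · rw [AffineMap.homothety_eq_lineMap]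
      exact hc.lineMap_mem hu hvK ⟨hr0, hr1⟩
    · rw [AffineMap.homothety_apply, vsub_eq_sub, vadd_eq_add, inner_add_left,
        real_inner_smul_left, inner_sub_left]
      have h1 : r * (H - a) = H - a' := by rw [hr]; field_simp
      have h2 : r * a ≤ r * inner ℝ v x := mul_le_mul_of_nonneg_left hva hr0
      change a' ≤ r * (inner ℝ v x - H) + H
      nlinarith
  have hvol : r ^ d * volume.real P ≤ volume.real Q := by
    have h := measureReal_mono (μ := volume) himg
      (measure_subset_ne_top hK (Set.sep_subset _ _))
    rwa [measureReal_def, Measure.addHaar_image_homothety, ENNReal.toReal_mul,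
      finrank_euclideanSpace_fin, ENNReal.toReal_ofReal (abs_nonneg _),
      abs_of_nonneg (by positivity), ← measureReal_def] at h
  have hsplit : volume.real {v ∈ K | a ≤ inner ℝ v x ∧ inner ℝ v x ≤ a'} + volume.real Q ≤
      volume.real P := by
    have hdis : AEDisjoint volume {v ∈ K | a ≤ inner ℝ v x ∧ inner ℝ v x ≤ a'} Q := by
      refine measure_mono_null ?_ (volume_hyperplane hx a')
      rintro v ⟨⟨_, _, h1⟩, _, h2⟩
      exact le_antisymm h1 h2
    rw [← measureReal_union₀ (measurableSet_cap hK x a').nullMeasurableSet hdis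
      (measure_subset_ne_top hK (Set.sep_subset _ _))
      (measure_subset_ne_top hK (Set.sep_subset _ _))]
    refine measureReal_mono ?_ (measure_subset_ne_top hK (Set.sep_subset _ _))
    rintro v (⟨h1, h2, _⟩ | ⟨h1, h2⟩)
    exacts [⟨h1, h2⟩, ⟨h1, haa.trans h2⟩]
  have hPV : volume.real P ≤ volume.real K :=
    measureReal_mono (Set.sep_subset _ _) hK.measure_lt_top.ne
  -- Bernoulli: `1 - r ^ d ≤ d * (1 - r)`.
  have hbern := one_add_mul_sub_le_pow (by linarith : -1 ≤ r) d
  have hone : 1 - r = (a' - a) / (H - a) := by rw [hr]; field_simp; ring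
  have hP0 : 0 ≤ volume.real P := measureReal_nonneg
  calc _ ≤ (1 - r ^ d) * volume.real P := by linarith
    _ ≤ (d * (1 - r)) * volume.real P := by gcongr; linarith
    _ ≤ (d * (1 - r)) * volume.real K := by
      gcongr
    _ = _ := by rw [hone]; ring

/-- A thin slab is a small part of the volume of a wide convex body. -/
theorem volume_slab_le {K : Set (Vec d)} (hK : IsCompact K) (hc : Convex ℝ K) {x u u' : Vec d}
    (hu : u ∈ K) (hu' : u' ∈ K) {a a' w : ℝ} (haa : a ≤ a') (hw0 : 0 < w)
    (hw : w ≤ inner ℝ u' x - inner ℝ u x) (ha : 2 * (a' - a) ≤ w) :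
    volume.real {v ∈ K | a ≤ inner ℝ v x ∧ inner ℝ v x ≤ a'} ≤
      2 * d * (a' - a) / w * volume.real K := by
  have hx : x ≠ 0 := by
    rintro rfl
    simp at hw; linarith
  have key : ∀ D : ℝ, w / 2 ≤ D → d * (a' - a) / D * volume.real K ≤
      2 * d * (a' - a) / w * volume.real K := fun D hD => by
    have h1 : (0 : ℝ) ≤ d * (a' - a) := mul_nonneg (Nat.cast_nonneg _) (by linarith)
    calc _ ≤ d * (a' - a) / (w / 2) * volume.real K := by gcongr
      _ = _ := by field_simp
  -- The slab is at most half as thick as the body is wide, so it lies beyond one of the two points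
  -- with `w / 2` to spare; that point is the apex. The second case is reflected by `x ↦ -x`.
  rcases le_total (w / 2) (inner ℝ u' x - a) with h | h
  · exact (volume_slab_le_of_apex hK hc hu' hx haa (by linarith) (by linarith)).trans (key _ h)
  · have h' : w / 2 ≤ a' - inner ℝ u x := by linarith
    have := volume_slab_le_of_apex hK hc hu (neg_ne_zero.2 hx) (neg_le_neg haa)
      (by rw [inner_neg_right]; linarith) (by rw [inner_neg_right]; linarith)
    have hset : {v ∈ K | -a' ≤ inner ℝ v (-x) ∧ inner ℝ v (-x) ≤ -a} =
        {v ∈ K | a ≤ inner ℝ v x ∧ inner ℝ v x ≤ a'} := by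
      ext v
      simp only [Set.mem_ofPred_eq, inner_neg_right, neg_le_neg_iff]
      tauto
    rw [hset, inner_neg_right] at this
    refine this.trans ?_
    rw [show -a - -a' = a' - a by ring, show -inner ℝ u x - -a' = a' - inner ℝ u x by ring]
    exact key _ h'

/-- Every fraction of the volume of a compact set is cut off by some hyperplane orthogonal to a
given direction. -/
theorem exists_volume_cap_eq {K : Set (Vec d)} (hK : IsCompact K) (hne : K.Nonempty) {x : Vec d}
    (hx : x ≠ 0) {f : ℝ} (hf0 : 0 ≤ f) (hf1 : f ≤ 1) :
    ∃ m : ℝ, volume {v ∈ K | m ≤ inner ℝ v x} = ENNReal.ofReal f * volume K := by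
  have hcont : Continuous fun m : ℝ => volume.real {v ∈ K | m ≤ inner ℝ v x} := by
    have h1 : ∀ m : ℝ, volume.real {v ∈ K | m ≤ inner ℝ v x} =
        ∫ v in K, (Set.Ici m).indicator (fun _ => (1 : ℝ)) (inner ℝ v x) := fun m => by
      have : (fun v : Vec d => (Set.Ici m).indicator (fun _ => (1 : ℝ)) (inner ℝ v x)) =
          {v : Vec d | m ≤ inner ℝ v x}.indicator 1 := by
        ext v; simp [Set.indicator_apply]
      rw [this, integral_indicator_one (measurableSet_le measurable_const (by fun_prop)),
        measureReal_restrict_apply (measurableSet_le measurable_const (by fun_prop)),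
        Set.inter_comm]
      rfl
    simp_rw [h1]
    refine continuous_iff_continuousAt.2 fun m => ?_
    refine continuousAt_of_dominated (bound := fun _ => 1) ?_ ?_ ?_ ?_
    · refine Filter.Eventually.of_forall fun y => Measurable.aestronglyMeasurable ?_
      exact (measurable_const.indicator measurableSet_Ici).comp (by fun_prop)
    · refine Filter.Eventually.of_forall fun y => Filter.Eventually.of_forall fun v => ?_
      by_cases hv : y ≤ inner ℝ v x <;> simp [hv]
    · exact integrableOn_const hK.measure_lt_top.ne
    -- Off the null hyperplane at level `m`, the indicator is locally constant in the threshold.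
    · have hae : ∀ᵐ v : Vec d ∂(volume.restrict K), inner ℝ v x ≠ m :=
        ae_restrict_of_ae (by
          rw [ae_iff]; simpa using volume_hyperplane hx m)
      filter_upwards [hae] with v hv
      rcases lt_or_gt_of_ne hv with h | h
      · refine (continuousAt_const (y := (0 : ℝ))).congr ?_
        filter_upwards [lt_mem_nhds h] with y hy
        simp [hy]
      · refine (continuousAt_const (y := (1 : ℝ))).congr ?_
        filter_upwards [gt_mem_nhds h] with y hy
        simp [hy.le]
  have hcomp : IsCompact ((fun v : Vec d => (inner ℝ v x : ℝ)) '' K) :=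
    hK.image (by fun_prop)
  obtain ⟨lo', hlo⟩ := hcomp.bddBelow
  obtain ⟨hi', hhi⟩ := hcomp.bddAbove
  have hle : lo' ≤ hi' := by
    obtain ⟨v, hv⟩ := hne
    exact (hlo ⟨v, hv, rfl⟩).trans (hhi ⟨v, hv, rfl⟩)
  have hfull : {v ∈ K | lo' ≤ inner ℝ v x} = K :=
    Set.sep_eq_self_iff_mem_true.2 fun v hv => hlo ⟨v, hv, rfl⟩
  have hempty : {v ∈ K | hi' + 1 ≤ inner ℝ v x} = ∅ :=
    Set.eq_empty_of_forall_notMem fun v hv => by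
      have h1 : inner ℝ v x ≤ hi' := hhi ⟨v, hv.1, rfl⟩
      linarith [hv.2]
  have hV : 0 ≤ volume.real K := measureReal_nonneg
  obtain ⟨m, -, hm⟩ := intermediate_value_Icc' (a := lo') (b := hi' + 1) (by linarith)
    hcont.continuousOn (show f * volume.real K ∈ _ by
      simp only [hfull, hempty, measureReal_empty]
      exact ⟨by positivity, mul_le_of_le_one_left hV hf1⟩)
  refine ⟨m, ?_⟩
  beta_reduce at hm
  rw [← ofReal_measureReal (measure_subset_ne_top hK (Set.sep_subset _ _)), hm,
    ENNReal.ofReal_mul hf0, ofReal_measureReal hK.measure_lt_top.ne]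

theorem subset_fatten (K : Set (Vec d)) (i : ℕ) : K ⊆ fatten K i := fun v hv =>
  ⟨v, hv, 0, ⟨0, by simp [unitBall], by simp⟩, by simp⟩

theorem abs_inner_le_one {v x : Vec d} (hv : v ∈ unitBall d) (hx : x ∈ unitBall d) :
    |inner ℝ v x| ≤ 1 := by
  have h1 : ‖v‖ ≤ 1 := by simpa [unitBall] using hv
  have h2 : ‖x‖ ≤ 1 := by simpa [unitBall] using hx
  exact (abs_real_inner_le_norm v x).trans (mul_le_one₀ h1 (norm_nonneg _) h2)

/-! ### Confidence regions -/

/-- A confidence region: a compact convex part of the unit ball that contains the hidden vector. -/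
structure IsConfidenceRegion (K : Set (Vec d)) (s : Vec d) : Prop where
  isCompact : IsCompact K
  convex : Convex ℝ K
  subset : K ⊆ unitBall d
  mem : s ∈ K

theorem isConfidenceRegion_unitBall {s : Vec d} (hs : s ∈ unitBall d) :
    IsConfidenceRegion (unitBall d) s :=
  ⟨isCompact_closedBall _ _, convex_closedBall _ _, subset_rfl, hs⟩

namespace IsConfidenceRegion

variable {K : Set (Vec d)} {s : Vec d}

theorem sep_le (h : IsConfidenceRegion K s) {x : Vec d} {p : ℝ} (hs : inner ℝ s x ≤ p) :
    IsConfidenceRegion {v ∈ K | inner ℝ v x ≤ p} s where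
  isCompact := h.isCompact.inter_right (isClosed_le
    (by fun_prop : Continuous fun v : Vec d => inner ℝ v x) continuous_const)
  convex := h.convex.inter (convex_halfSpace_le
    ⟨fun v w => inner_add_left v w x, fun c v => real_inner_smul_left v x c⟩ p)
  subset := (Set.sep_subset _ _).trans h.subset
  mem := ⟨h.mem, hs⟩

theorem sep_ge (h : IsConfidenceRegion K s) {x : Vec d} {p : ℝ} (hs : p ≤ inner ℝ s x) :
    IsConfidenceRegion {v ∈ K | p ≤ inner ℝ v x} s where
  isCompact := h.isCompact.inter_right (isClosed_le continuous_const
    (by fun_prop : Continuous fun v : Vec d => inner ℝ v x))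
  convex := h.convex.inter (convex_halfSpace_ge
    ⟨fun v w => inner_add_left v w x, fun c v => real_inner_smul_left v x c⟩ p)
  subset := (Set.sep_subset _ _).trans h.subset
  mem := ⟨h.mem, hs⟩

theorem isCompact_proj (h : IsConfidenceRegion K s) (x : Vec d) : IsCompact (proj K x) :=
  h.isCompact.image (by fun_prop)

theorem inner_le_hi (h : IsConfidenceRegion K s) (x : Vec d) {v : Vec d} (hv : v ∈ K) :
    inner ℝ v x ≤ hi K x :=
  le_csSup (h.isCompact_proj x).bddAbove ⟨v, hv, rfl⟩

theorem lo_le_inner (h : IsConfidenceRegion K s) (x : Vec d) {v : Vec d} (hv : v ∈ K) :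
    lo K x ≤ inner ℝ v x :=
  csInf_le (h.isCompact_proj x).bddBelow ⟨v, hv, rfl⟩

theorem exists_eq_hi (h : IsConfidenceRegion K s) (x : Vec d) : ∃ v ∈ K, inner ℝ v x = hi K x :=
  (h.isCompact_proj x).sSup_mem ⟨_, s, h.mem, rfl⟩

theorem exists_eq_lo (h : IsConfidenceRegion K s) (x : Vec d) : ∃ v ∈ K, inner ℝ v x = lo K x :=
  (h.isCompact_proj x).sInf_mem ⟨_, s, h.mem, rfl⟩

theorem width_le (h : IsConfidenceRegion K s) {x : Vec d} (hx : x ∈ unitBall d) :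
    width K x ≤ 2 := by
  have key : ∀ v ∈ K, |inner ℝ v x| ≤ 1 := fun v hv => abs_inner_le_one (h.subset hv) hx
  obtain ⟨u, hu, hu'⟩ := h.exists_eq_hi x
  obtain ⟨v, hv, hv'⟩ := h.exists_eq_lo x
  have h1 := abs_le.1 (key u hu)
  have h2 := abs_le.1 (key v hv)
  rw [width]; linarith [h1.2, h2.1]

theorem isCompact_fatten (h : IsConfidenceRegion K s) (i : ℕ) : IsCompact (fatten K i) :=
  h.isCompact.add ((isCompact_closedBall _ _).smul _)

theorem convex_fatten (h : IsConfidenceRegion K s) (i : ℕ) : Convex ℝ (fatten K i) :=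
  h.convex.add ((convex_closedBall _ _).smul _)

theorem closedBall_subset_fatten (h : IsConfidenceRegion K s) (hd : 1 ≤ d) (i : ℕ) :
    Metric.closedBall s (scale d i) ⊆ fatten K i := by
  have hz := scale_pos hd i
  intro v hv
  refine ⟨s, h.mem, v - s, ?_, by simp⟩
  rw [unitBall, smul_unitClosedBall_of_nonneg hz.le]
  simpa [dist_eq_norm] using hv

/-- A region itself may become flat; the ball around the hidden vector keeps the fattened volume
bounded below, uniformly over all rounds. -/
theorem volume_fatten_ge (h : IsConfidenceRegion K s) (hd : 1 ≤ d) (i : ℕ) :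
    scale d i ^ d * volume.real (unitBall d) ≤ volume.real (fatten K i) := by
  have := measureReal_mono (μ := volume) (h.closedBall_subset_fatten hd i)
    (h.isCompact_fatten i).measure_lt_top.ne
  rwa [Measure.addHaar_real_closedBall' _ _ (scale_pos hd i).le, finrank_euclideanSpace_fin] at this

theorem volume_fatten_pos (h : IsConfidenceRegion K s) (hd : 1 ≤ d) (i : ℕ) :
    0 < volume.real (fatten K i) := by
  refine lt_of_lt_of_le ?_ (h.volume_fatten_ge hd i)
  refine mul_pos (pow_pos (scale_pos hd i) _) ?_
  exact ENNReal.toReal_pos (Metric.measure_closedBall_pos _ _ one_pos).ne'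
    (isCompact_closedBall _ _).measure_lt_top.ne

theorem volume_fatten_le (h : IsConfidenceRegion K s) (hd : 1 ≤ d) (i : ℕ) :
    volume.real (fatten K i) ≤ (1 + scale d i) ^ d * volume.real (unitBall d) := by
  have hz := scale_pos hd i
  have hsub : fatten K i ⊆ Metric.closedBall 0 (1 + scale d i) := by
    rintro _ ⟨v, hv, _, ⟨w, hw, rfl⟩, rfl⟩
    have h1 : ‖v‖ ≤ 1 := by simpa [unitBall] using h.subset hv
    have h2 : ‖w‖ ≤ 1 := by simpa [unitBall] using hw
    rw [mem_closedBall_zero_iff]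
    refine (norm_add_le _ _).trans (add_le_add h1 ?_)
    simp only [norm_smul, Real.norm_eq_abs, abs_of_pos hz]
    nlinarith
  have := measureReal_mono (μ := volume) hsub (isCompact_closedBall _ _).measure_lt_top.ne
  rwa [Measure.addHaar_real_closedBall' _ _ (by linarith), finrank_euclideanSpace_fin] at this

end IsConfidenceRegion

theorem fatten_mono {K L : Set (Vec d)} (h : K ⊆ L) (i : ℕ) : fatten K i ⊆ fatten L i :=
  Set.add_subset_add_right h

theorem exists_of_mem_fatten (hd : 1 ≤ d) {K : Set (Vec d)} {i : ℕ} {v x : Vec d}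
    (hv : v ∈ fatten K i) (hx : x ∈ unitBall d) :
    ∃ u ∈ K, |inner ℝ v x - inner ℝ u x| ≤ scale d i := by
  have hz := scale_pos hd i
  obtain ⟨u, hu, _, ⟨w, hw, rfl⟩, rfl⟩ := hv
  refine ⟨u, hu, ?_⟩
  have h3 : |inner ℝ w x| ≤ 1 := abs_inner_le_one hw hx
  simp only [inner_add_left, real_inner_smul_left, add_sub_cancel_left, abs_mul, abs_of_pos hz]
  nlinarith

/-! ### Effect of an unbalanced price on the fattened volume -/

section UnbalancedPrice

variable {K : Set (Vec d)} {s x : Vec d}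

theorem exists_isUnbalancedSellerPrice (h : IsConfidenceRegion K s) (hx : x ≠ 0) (i : ℕ) :
    ∃ p, IsUnbalancedSellerPrice K x i p := by
  obtain ⟨m, hm⟩ := exists_volume_cap_eq (h.isCompact_fatten i)
    ⟨s, subset_fatten _ _ h.mem⟩ hx (fraction_pos i).le (fraction_lt_one i).le
  exact ⟨_, m, hm, rfl⟩

/-- The slab of thickness twice the scale is at most a quarter of the critical cap. -/
theorem volume_slab_scale_le (h : IsConfidenceRegion K s) (hd : 1 ≤ d) {i : ℕ}
    (hw : fraction i ^ 4 < width K x) (a : ℝ) :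
    volume.real {v ∈ fatten K i | a ≤ inner ℝ v x ∧ inner ℝ v x ≤ a + 2 * scale d i} ≤
      fraction i / 4 * volume.real (fatten K i) := by
  have hf0 := fraction_pos i
  have hf1 := fraction_lt_one i
  have hd' : (1 : ℝ) ≤ d := by exact_mod_cast hd
  have hz := scale_pos hd i
  have hzd : scale d i * d = fraction i ^ 6 / 16 := by rw [scale_eq]; field_simp
  have hf2 : fraction i ^ 2 ≤ fraction i := by nlinarith
  have h64 : fraction i ^ 6 = fraction i ^ 2 * fraction i ^ 4 := by ring
  have h4 : 0 < fraction i ^ 4 := by positivity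
  have hf21 : fraction i ^ 2 ≤ 1 := by linarith
  obtain ⟨u, hu, hu'⟩ := h.exists_eq_lo x
  obtain ⟨v, hv, hv'⟩ := h.exists_eq_hi x
  -- With thickness `2 * scale d i` and width at least `f ^ 4`, the ratio is `4 * d * scale d i / f
  -- ^ 4 = f ^ 2 / 4`.
  have key := volume_slab_le (h.isCompact_fatten i) (h.convex_fatten i)
    (subset_fatten _ _ hu) (subset_fatten _ _ hv)
    (a := a) (a' := a + 2 * scale d i) (x := x) (by linarith) h4
    (by have := hw.le; rw [width, ← hu', ← hv'] at this; exact this) (by nlinarith)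
  refine key.trans ?_
  refine mul_le_mul_of_nonneg_right ?_ measureReal_nonneg
  rw [div_le_iff₀ h4]
  nlinarith

variable {i : ℕ} {p : ℝ}

theorem IsUnbalancedSellerPrice.volume_cap (hp : IsUnbalancedSellerPrice K x i p) :
    volume.real {v ∈ fatten K i | p - scale d i ≤ inner ℝ v x} =
      fraction i * volume.real (fatten K i) := by
  obtain ⟨m, hm, rfl⟩ := hp
  rw [add_sub_cancel_right, measureReal_def, hm, ENNReal.toReal_mul,
    ENNReal.toReal_ofReal (fraction_pos i).le, measureReal_def]

/-- Otherwise the whole critical cap, a fraction `f` of the volume, would lie in a slab of thickness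
`2 * scale d i`, which holds at most `f / 4`. -/
theorem IsUnbalancedSellerPrice.lt_hi (hp : IsUnbalancedSellerPrice K x i p)
    (h : IsConfidenceRegion K s) (hd : 1 ≤ d) (hx : x ∈ unitBall d)
    (hw : fraction i ^ 4 < width K x) : p < hi K x := by
  by_contra! hle
  have h1 := hp.volume_cap
  have h2 := volume_slab_scale_le h hd hw (p - scale d i)
  have h3 : volume.real {v ∈ fatten K i | p - scale d i ≤ inner ℝ v x} ≤
      volume.real {v ∈ fatten K i | p - scale d i ≤ inner ℝ v x ∧
        inner ℝ v x ≤ p - scale d i + 2 * scale d i} := by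
    refine measureReal_mono ?_ (measure_subset_ne_top (h.isCompact_fatten i) (Set.sep_subset _ _))
    rintro v ⟨hv, hv'⟩
    obtain ⟨u, hu, hu'⟩ := exists_of_mem_fatten hd hv hx
    exact ⟨hv, hv', by linarith [(abs_le.1 hu').2, h.inner_le_hi x hu]⟩
  have h4 := mul_pos (fraction_pos i) (h.volume_fatten_pos hd i)
  linarith

/-- The offset of the price above `m` equals the fattening radius, so fattening the rejected part
does not leave the cap above `m`. -/
theorem IsUnbalancedSellerPrice.volume_reject (hp : IsUnbalancedSellerPrice K x i p)
    (h : IsConfidenceRegion K s) (hd : 1 ≤ d) (hx : x ∈ unitBall d) :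
    volume.real (fatten {v ∈ K | p ≤ inner ℝ v x} i) ≤
      fraction i * volume.real (fatten K i) := by
  rw [← hp.volume_cap]
  refine measureReal_mono ?_ (measure_subset_ne_top (h.isCompact_fatten i) (Set.sep_subset _ _))
  intro v hv
  obtain ⟨u, hu, hu'⟩ := exists_of_mem_fatten hd hv hx
  exact ⟨fatten_mono (Set.sep_subset _ _) i hv, by linarith [(abs_le.1 hu').1, hu.2]⟩

/-- The price of that offset: the fattened accepted part may enter the cap, but only by a slab of
thickness `2 * scale d i`. The volume left is at most `1 - f + f / 4` of the whole. -/
theorem IsUnbalancedSellerPrice.volume_accept (hp : IsUnbalancedSellerPrice K x i p)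
    (h : IsConfidenceRegion K s) (hd : 1 ≤ d) (hx : x ∈ unitBall d)
    (hw : fraction i ^ 4 < width K x) :
    volume.real (fatten {v ∈ K | inner ℝ v x ≤ p} i) ≤
      (1 - fraction i / 2) * volume.real (fatten K i) := by
  have hK := h.isCompact_fatten i
  have h1 := hp.volume_cap
  have h2 := volume_slab_scale_le h hd hw (p - scale d i)
  set m := p - scale d i with hm
  have h3 := measureReal_inter_add_sdiff (μ := volume) (s := fatten K i)
    (t := {v | m ≤ inner ℝ v x}) (measurableSet_le measurable_const (by fun_prop))
    hK.measure_lt_top.ne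
  change volume.real {v ∈ fatten K i | m ≤ inner ℝ v x} + _ = _ at h3
  have h4 : volume.real (fatten {v ∈ K | inner ℝ v x ≤ p} i) ≤
      volume.real ({v ∈ fatten K i | m ≤ inner ℝ v x ∧ inner ℝ v x ≤ m + 2 * scale d i} ∪
        (fatten K i \ {v | m ≤ inner ℝ v x})) := by
    refine measureReal_mono ?_ (measure_subset_ne_top hK
      (Set.union_subset (Set.sep_subset _ _) Set.sdiff_subset))
    intro v hv
    obtain ⟨u, hu, hu'⟩ := exists_of_mem_fatten hd hv hx
    have hvK := fatten_mono (Set.sep_subset _ _) i hv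
    by_cases hvm : m ≤ inner ℝ v x
    · exact Or.inl ⟨hvK, hvm, by linarith [(abs_le.1 hu').2, hu.2]⟩
    · exact Or.inr ⟨hvK, hvm⟩
  have h5 := measureReal_union_le (μ := volume)
    {v ∈ fatten K i | m ≤ inner ℝ v x ∧ inner ℝ v x ≤ m + 2 * scale d i}
    (fatten K i \ {v | m ≤ inner ℝ v x})
  have h6 := mul_pos (fraction_pos i) (h.volume_fatten_pos hd i)
  linarith

end UnbalancedPrice

/-- The logarithm of the volume of a fattened region. -/
noncomputable def potential (K : Set (Vec d)) (i : ℕ) : ℝ := Real.log (volume.real (fatten K i))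

/-! ### Decrease of the potentials -/

section Potential

variable {K L : Set (Vec d)} {s x : Vec d}

theorem potential_mono (hK : IsConfidenceRegion K s) (hL : IsConfidenceRegion L s) (hd : 1 ≤ d)
    (h : K ⊆ L) (i : ℕ) : potential K i ≤ potential L i :=
  Real.log_le_log (hK.volume_fatten_pos hd i)
    (measureReal_mono (fatten_mono h i) (hL.isCompact_fatten i).measure_lt_top.ne)

/-- The total decrease of a potential is at most `d * log (1 + 1 / z_i)`. -/
theorem potential_sub_le (hK : IsConfidenceRegion K s) (hL : IsConfidenceRegion L s) (hd : 1 ≤ d)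
    (i : ℕ) : potential K i - potential L i ≤ d * (Real.log (d + 1) + 6 * 2 ^ i) := by
  have hz := scale_pos hd i
  have hK0 := hK.volume_fatten_pos hd i
  have hL0 := hL.volume_fatten_pos hd i
  have hKu := hK.volume_fatten_le hd i
  have hLl := hL.volume_fatten_ge hd i
  set β := volume.real (unitBall d)
  have hβ : 0 < β := by
    by_contra! h
    have : (1 + scale d i) ^ d * β ≤ 0 := mul_nonpos_of_nonneg_of_nonpos (by positivity) h
    linarith
  calc potential K i - potential L i
      = Real.log (volume.real (fatten K i) / volume.real (fatten L i)) :=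
        (Real.log_div hK0.ne' hL0.ne').symm
    _ ≤ Real.log ((1 + scale d i) ^ d * β / (scale d i ^ d * β)) := by
        refine Real.log_le_log (by positivity) ?_
        gcongr
    _ = d * Real.log ((1 + scale d i) / scale d i) := by
        rw [mul_div_mul_right _ _ hβ.ne', ← div_pow, Real.log_pow]
    _ ≤ _ := by gcongr; exact log_scale_le hd i

variable {i : ℕ} {p : ℝ}

theorem IsUnbalancedSellerPrice.potential_reject (hp : IsUnbalancedSellerPrice K x i p)
    (h : IsConfidenceRegion K s) (hd : 1 ≤ d) (hx : x ∈ unitBall d) (hs : p ≤ inner ℝ s x) :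
    2 ^ i / 2 * Real.log 2 ≤ potential K i - potential {v ∈ K | p ≤ inner ℝ v x} i := by
  have h1 := Real.log_le_log ((h.sep_ge hs).volume_fatten_pos hd i) (hp.volume_reject h hd hx)
  rw [Real.log_mul (fraction_pos i).ne' (h.volume_fatten_pos hd i).ne', log_fraction] at h1
  unfold potential
  linarith

theorem IsUnbalancedSellerPrice.potential_accept (hp : IsUnbalancedSellerPrice K x i p)
    (h : IsConfidenceRegion K s) (hd : 1 ≤ d) (hx : x ∈ unitBall d)
    (hw : fraction i ^ 4 < width K x) (hs : inner ℝ s x ≤ p) :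
    fraction i / 2 ≤ potential K i - potential {v ∈ K | inner ℝ v x ≤ p} i := by
  have hf := fraction_lt_one i
  have h1 := Real.log_le_log ((h.sep_le hs).volume_fatten_pos hd i) (hp.volume_accept h hd hx hw)
  rw [Real.log_mul (by linarith) (h.volume_fatten_pos hd i).ne'] at h1
  have h2 := Real.log_le_sub_one_of_pos (x := 1 - fraction i / 2) (by linarith)
  unfold potential
  linarith

/-! ### Reflection of the context and endpoints of projections -/

theorem proj_neg (K : Set (Vec d)) (x : Vec d) : proj K (-x) = -proj K x := by
  ext y
  simp [proj, inner_neg_right, neg_eq_iff_eq_neg]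

theorem disjoint_proj_neg_iff :
    Disjoint (proj K (-x)) (proj L (-x)) ↔ Disjoint (proj K x) (proj L x) := by
  rw [proj_neg, proj_neg, ← Set.image_neg_eq_neg, ← Set.image_neg_eq_neg,
    Set.disjoint_image_iff neg_injective]

theorem hi_neg (K : Set (Vec d)) (x : Vec d) : hi K (-x) = -lo K x := by
  rw [hi, proj_neg, Real.sSup_neg, lo]

theorem lo_neg (K : Set (Vec d)) (x : Vec d) : lo K (-x) = -hi K x := by
  rw [lo, proj_neg, Real.sInf_neg, hi]

theorem width_neg (K : Set (Vec d)) (x : Vec d) : width K (-x) = width K x := by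
  rw [width, width, hi_neg, lo_neg]; ring

theorem isUnbalancedSellerPrice_neg_iff {q : ℝ} :
    IsUnbalancedSellerPrice K (-x) i (-q) ↔ IsUnbalancedBuyerPrice K x i q := by
  constructor
  · rintro ⟨m, hm, hq⟩
    refine ⟨-m, ?_, by linarith⟩
    rw [← hm]; simp only [inner_neg_right, le_neg]
  · rintro ⟨m, hm, hq⟩
    refine ⟨-m, ?_, by linarith⟩
    rw [← hm]; simp only [inner_neg_right, neg_le_neg_iff]

/-- Convex sets are connected, so projections are intervals and their disjointness can be read off
from the endpoints. -/
theorem IsConfidenceRegion.Icc_subset_proj (h : IsConfidenceRegion K s) (x : Vec d) :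
    Set.Icc (lo K x) (hi K x) ⊆ proj K x := by
  obtain ⟨u, hu, hu'⟩ := h.exists_eq_lo x
  obtain ⟨v, hv, hv'⟩ := h.exists_eq_hi x
  have hc : IsPreconnected (proj K x) := h.convex.isPreconnected.image _ (by fun_prop)
  exact hc.Icc_subset ⟨u, hu, hu'⟩ ⟨v, hv, hv'⟩

theorem not_disjoint_proj_iff {b : Vec d} (hK : IsConfidenceRegion K s)
    (hL : IsConfidenceRegion L b) :
    ¬ Disjoint (proj K x) (proj L x) ↔ lo L x ≤ hi K x ∧ lo K x ≤ hi L x := by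
  rw [Set.not_disjoint_iff]
  constructor
  · rintro ⟨_, ⟨u, hu, rfl⟩, v, hv, hvu⟩
    have h1 := hK.inner_le_hi x hu
    have h2 := hK.lo_le_inner x hu
    have h3 := hL.inner_le_hi x hv
    have h4 := hL.lo_le_inner x hv
    dsimp only at hvu
    constructor <;> linarith
  · rintro ⟨h1, h2⟩
    have h3 := (hK.lo_le_inner x hK.mem).trans (hK.inner_le_hi x hK.mem)
    have h4 := (hL.lo_le_inner x hL.mem).trans (hL.inner_le_hi x hL.mem)
    exact ⟨max (lo K x) (lo L x),
      hK.Icc_subset_proj x ⟨le_max_left _ _, max_le h3 h1⟩,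
      hL.Icc_subset_proj x ⟨le_max_right _ _, max_le h2 h4⟩⟩

end Potential

/-! ### The loss of a single round -/

/-- The regret of a single round. -/
noncomputable def roundRegret (s b x : Vec d) (p q : ℝ) : ℝ :=
  max (inner ℝ b x - inner ℝ s x) 0 - profit s b x p q

/-- The negative profit of a single round. -/
noncomputable def roundLoss (s b x : Vec d) (p q : ℝ) : ℝ := max 0 (-profit s b x p q)

/-- The price per unit of potential at level `i`. -/
noncomputable def rate (i : ℕ) : ℝ := 16 * fraction i + 4 / (2 ^ i * Real.log 2)

theorem profit_eq (s b x : Vec d) (p q : ℝ) :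
    profit s b x p q = if inner ℝ s x ≤ p ∧ q ≤ inner ℝ b x then q - p else 0 := by
  simp [profit, tradeBit]

/-- Swapping the agents while negating the context and the prices is a symmetry of the model; it
reduces buyer-dominated rounds to seller-dominated ones. -/
theorem tradeBit_neg (s b x : Vec d) (p q : ℝ) :
    tradeBit b s (-x) (-q) (-p) = tradeBit s b x p q := by
  simp only [tradeBit, inner_neg_right, neg_le_neg_iff]
  exact decide_eq_decide.2 and_comm

theorem profit_neg (s b x : Vec d) (p q : ℝ) :
    profit b s (-x) (-q) (-p) = profit s b x p q := by
  rw [profit, profit, tradeBit_neg]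
  congr 1; ring

theorem roundRegret_neg (s b x : Vec d) (p q : ℝ) :
    roundRegret b s (-x) (-q) (-p) = roundRegret s b x p q := by
  rw [roundRegret, roundRegret, profit_neg, inner_neg_right, inner_neg_right]
  congr 2; ring

theorem roundLoss_neg (s b x : Vec d) (p q : ℝ) :
    roundLoss b s (-x) (-q) (-p) = roundLoss s b x p q := by
  rw [roundLoss, roundLoss, profit_neg]

theorem rate_pos (i : ℕ) : 0 < rate i := by
  have := Real.log_pos one_lt_two
  have := fraction_pos i
  unfold rate; positivity

theorem Regions.update_swap (R : Regions d) (x : Vec d) (p q : ℝ) (tr : Bool) :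
    ((⟨R.buyer, R.seller⟩ : Regions d).update (-x) (-q) (-p) tr).seller =
      (R.update x p q tr).buyer := by
  simp only [Regions.update, lo_neg, neg_le_neg_iff, inner_neg_right]

section Round

variable {R : Regions d} {s b x : Vec d} {p q : ℝ}

/-- A cut is made only if the buyer surely accepts, so a missing trade means that the seller refused
and the hidden vector survives the cut. -/
theorem IsConfidenceRegion.update_seller (hS : IsConfidenceRegion R.seller s)
    (hB : IsConfidenceRegion R.buyer b) (x : Vec d) (p q : ℝ) :
    IsConfidenceRegion (R.update x p q (tradeBit s b x p q)).seller s := by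
  unfold Regions.update tradeBit
  dsimp only
  split_ifs with h1 h2
  · exact hS.sep_le (decide_eq_true_iff.1 h2).1
  · refine hS.sep_ge (le_of_not_ge fun h => h2 (decide_eq_true ⟨h, ?_⟩))
    exact h1.trans (hB.lo_le_inner x hB.mem)
  · exact hS

theorem IsConfidenceRegion.update_buyer (hS : IsConfidenceRegion R.seller s)
    (hB : IsConfidenceRegion R.buyer b) (x : Vec d) (p q : ℝ) :
    IsConfidenceRegion (R.update x p q (tradeBit s b x p q)).buyer b := by
  rw [← Regions.update_swap, ← tradeBit_neg]
  exact IsConfidenceRegion.update_seller (R := ⟨R.buyer, R.seller⟩) hB hS _ _ _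

theorem Regions.update_seller_subset (R : Regions d) (x : Vec d) (p q : ℝ) (tr : Bool) :
    (R.update x p q tr).seller ⊆ R.seller := by
  unfold Regions.update
  dsimp only
  split_ifs
  exacts [Set.sep_subset _ _, Set.sep_subset _ _, subset_rfl]

theorem Regions.update_buyer_subset (R : Regions d) (x : Vec d) (p q : ℝ) (tr : Bool) :
    (R.update x p q tr).buyer ⊆ R.buyer := by
  rw [← Regions.update_swap]
  exact Regions.update_seller_subset _ _ _ _ _

/-- In a round dominated by the seller, the loss is paid for by the decrease of the potential of the
seller's region at the level of the round. -/
theorem round_le_of_seller_dominates (hd : 1 ≤ d) (hS : IsConfidenceRegion R.seller s)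
    (hB : IsConfidenceRegion R.buyer b) (hx : x ∈ unitBall d) (hw0 : 0 < width R.seller x)
    (hw : width R.buyer x ≤ width R.seller x)
    (hp : IsUnbalancedSellerPrice R.seller x (index (width R.seller x)) p)
    (hq : ¬ Disjoint (proj R.seller x) (proj R.buyer x) → q = lo R.buyer x)
    (hq' : Disjoint (proj R.seller x) (proj R.buyer x) → q = max p (lo R.buyer x))
    {i : ℕ} (hi : i = index (width R.seller x)) :
    roundLoss s b x p q ≤ 16 * fraction i * (potential R.seller i -
        potential (R.update x p q (tradeBit s b x p q)).seller i) ∧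
    roundRegret s b x p q ≤ rate i * (potential R.seller i -
        potential (R.update x p q (tradeBit s b x p q)).seller i) := by
  have hf0 := fraction_pos i
  have hl2 := Real.log_pos one_lt_two
  have hwl : fraction i ^ 4 < width R.seller x := hi ▸ lt_of_index hw0
  have hwu : width R.seller x ≤ 4 * fraction i ^ 2 := hi ▸ le_of_index hw0 (hS.width_le hx)
  rw [← hi] at hp
  have hphi := hp.lt_hi hS hd hx hwl
  have hs1 := hS.lo_le_inner x hS.mem
  have hs2 := hS.inner_le_hi x hS.mem
  have hb1 := hB.lo_le_inner x hB.mem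
  have hb2 := hB.inner_le_hi x hB.mem
  have hΔ := sub_nonneg.2 (potential_mono (hS.update_seller hB x p q) hS hd
    (R.update_seller_subset x p q _) i)
  set Δ := potential R.seller i -
        potential (R.update x p q (tradeBit s b x p q)).seller i with hΔdef
  have hrate : 16 * fraction i ≤ rate i := by
    have : 0 < 4 / ((2 : ℝ) ^ i * Real.log 2) := by positivity
    unfold rate; linarith
  have hrate' : 4 / ((2 : ℝ) ^ i * Real.log 2) ≤ rate i := by unfold rate; linarith
  have hr0 := rate_pos i
  -- `2 * w ≤ 8 * f ^ 2 = 16 * f * (f / 2)`.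
  have accept (h : fraction i / 2 ≤ Δ) {y : ℝ} (hy : y ≤ 2 * width R.seller x) :
      y ≤ 16 * fraction i * Δ := by
    have := mul_le_mul_of_nonneg_left h (by positivity : 0 ≤ 16 * fraction i)
    nlinarith
  have reject (h : 2 ^ i / 2 * Real.log 2 ≤ Δ) : 2 ≤ rate i * Δ := by
    calc (2 : ℝ) = 4 / (2 ^ i * Real.log 2) * (2 ^ i / 2 * Real.log 2) := by
          field_simp; norm_num
      _ ≤ rate i * Δ := by gcongr
  unfold roundLoss roundRegret
  rw [profit_eq]
  have hbs : inner ℝ b x - inner ℝ s x ≤ 2 := by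
    have h1 := abs_le.1 (abs_inner_le_one (hS.subset hS.mem) hx)
    have h2 := abs_le.1 (abs_inner_le_one (hB.subset hB.mem) hx)
    linarith [h1.1, h2.2]
  unfold width at hw hwl hwu hw0 accept
  -- If every buyer value lies below every seller value, there is no gain to lose, and the cap `p ≤
  -- q` rules out negative profit; no decrease of potential is needed.
  by_cases hidle : BilateralTrade.hi R.buyer x < lo R.seller x
  · have hdis : Disjoint (proj R.seller x) (proj R.buyer x) := by
      by_contra h
      have := (not_disjoint_proj_iff hS hB).1 h
      linarith [this.2]
    have hpq : p ≤ q := by rw [hq' hdis]; exact le_max_left _ _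
    have h1 : (0 : ℝ) ≤ 16 * fraction i * Δ := by positivity
    have h2 : 0 ≤ rate i * Δ := by positivity
    rw [max_eq_right (by linarith : inner ℝ b x - inner ℝ s x ≤ 0)]
    split_ifs
    · exact ⟨by rw [max_eq_left (by linarith)]; exact h1, by linarith⟩
    · simpa using ⟨h1, h2⟩
  -- When the projections are disjoint with the seller below, `p < hi R.seller x` makes the cap
  -- inactive, so the buyer's price is safe here too.
  · have hqe : q = lo R.buyer x := by
      by_cases hdis : Disjoint (proj R.seller x) (proj R.buyer x)
      · have h1 := mt (not_disjoint_proj_iff hS hB).2 (not_not.2 hdis)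
        have h2 : BilateralTrade.hi R.seller x < lo R.buyer x := by
          by_contra h
          exact h1 ⟨not_lt.1 h, not_lt.1 hidle⟩
        rw [hq' hdis, max_eq_right (by linarith)]
      · exact hq hdis
    have hsafe : q ≤ lo R.buyer x := hqe.le
    have htrade : tradeBit s b x p q = true ↔ inner ℝ s x ≤ p := by
      simp only [tradeBit, decide_eq_true_eq, and_iff_left_iff_imp]
      exact fun _ => hsafe.trans hb1
    by_cases hsp : inner ℝ s x ≤ p
    · have hup : (R.update x p q (tradeBit s b x p q)).seller =
          {v ∈ R.seller | inner ℝ v x ≤ p} := by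
        simp [Regions.update, hsafe, htrade.2 hsp]
      rw [hup] at hΔdef
      have hacc : fraction i / 2 ≤ Δ := hΔdef ▸ hp.potential_accept hS hd hx hwl hsp
      rw [if_pos ⟨hsp, hsafe.trans hb1⟩]
      -- Since `lo R.seller x ≤ hi R.buyer x`, the overpayment `p - q` is at most the sum of the two
      -- widths; so is `(b_t - q) + (p - s_t)`.
      refine ⟨max_le (by positivity) (accept hacc ?_), (accept hacc ?_).trans (by gcongr)⟩
      · rw [hqe]; linarith
      · rw [sub_le_iff_le_add, max_le_iff, hqe]; constructor <;> linarith
    · have hup : (R.update x p q (tradeBit s b x p q)).seller =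
          {v ∈ R.seller | p ≤ inner ℝ v x} := by
        simp [Regions.update, hsafe, mt htrade.1 hsp]
      rw [hup] at hΔdef
      have hrej := reject (hΔdef ▸ hp.potential_reject hS hd hx (not_le.1 hsp).le)
      rw [if_neg fun h => hsp h.1]
      refine ⟨by simp only [neg_zero, max_self]; positivity, ?_⟩
      rw [sub_zero]
      exact max_le (hbs.trans hrej) (by linarith)

/-- If both regions are narrow, nobody loses much. -/
theorem round_le_of_narrow {ε : ℝ} (hS : IsConfidenceRegion R.seller s)
    (hB : IsConfidenceRegion R.buyer b) (hw : max (width R.seller x) (width R.buyer x) ≤ ε)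
    (hp : p = hi R.seller x) (hq : q = max p (lo R.buyer x)) :
    roundLoss s b x p q ≤ 0 ∧ roundRegret s b x p q ≤ 2 * ε := by
  have hwS := (le_max_left _ _).trans hw
  have hwB := (le_max_right _ _).trans hw
  unfold width at hwS hwB
  have hs1 := hS.lo_le_inner x hS.mem
  have hs2 := hS.inner_le_hi x hS.mem
  have hb1 := hB.lo_le_inner x hB.mem
  have hb2 := hB.inner_le_hi x hB.mem
  have hpq : p ≤ q := by rw [hq]; exact le_max_left _ _
  have hql : lo R.buyer x ≤ q := by rw [hq]; exact le_max_right _ _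
  unfold roundLoss roundRegret
  rw [profit_eq]
  split_ifs with h
  · refine ⟨by rw [max_eq_left (by linarith)], ?_⟩
    rw [sub_le_iff_le_add, max_le_iff]
    constructor <;> linarith
  · refine ⟨by simp, ?_⟩
    rw [sub_zero, max_le_iff]
    refine ⟨?_, by linarith⟩
    have hqb : inner ℝ b x < q := by
      by_contra! hqb
      exact h ⟨hp ▸ hs2, hqb⟩
    -- The buyer would accept `lo R.buyer x`, so a refusal means that the maximum is `p`; the missed
    -- gain is then below the seller's width.
    have : q = p := by
      rw [hq]; refine max_eq_left ?_
      by_contra! hlt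
      rw [hq, max_eq_right hlt.le] at hqb
      linarith
    linarith

/-- The loss of a round is paid for by the decrease of the potentials of the two regions. -/
theorem PostsUnbalancedSafe.round_le {T : ℕ} (hT : 3 ≤ T) (hd : 1 ≤ d)
    (h : PostsUnbalancedSafe T R x p q) (hS : IsConfidenceRegion R.seller s)
    (hB : IsConfidenceRegion R.buyer b) (hx : x ∈ unitBall d) {R' : Regions d}
    (hR' : R' = R.update x p q (tradeBit s b x p q)) :
    roundLoss s b x p q ≤ ∑ i ∈ Finset.range (levels T), 16 * fraction i *
      ((potential R.seller i - potential R'.seller i) +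
        (potential R.buyer i - potential R'.buyer i)) ∧
    roundRegret s b x p q ≤ 2 * (1 / T) + ∑ i ∈ Finset.range (levels T), rate i *
      ((potential R.seller i - potential R'.seller i) +
        (potential R.buyer i - potential R'.buyer i)) := by
  obtain ⟨h1, h2, h3⟩ := h
  have hT0 : (0 : ℝ) < 1 / T := by positivity
  have hΔS (i : ℕ) : 0 ≤ potential R.seller i - potential R'.seller i := by
    rw [hR']
    exact sub_nonneg.2 (potential_mono (hS.update_seller hB x p q) hS hd
      (R.update_seller_subset x p q _) i)
  have hΔB (i : ℕ) : 0 ≤ potential R.buyer i - potential R'.buyer i := by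
    rw [hR']
    exact sub_nonneg.2 (potential_mono (hS.update_buyer hB x p q) hB hd
      (R.update_buyer_subset x p q _) i)
  have hterm1 (i : ℕ) : 0 ≤ 16 * fraction i * ((potential R.seller i - potential R'.seller i) +
      (potential R.buyer i - potential R'.buyer i)) :=
    mul_nonneg (by have := fraction_pos i; positivity) (add_nonneg (hΔS i) (hΔB i))
  have hterm2 (i : ℕ) : 0 ≤ rate i * ((potential R.seller i - potential R'.seller i) +
      (potential R.buyer i - potential R'.buyer i)) :=
    mul_nonneg (rate_pos i).le (add_nonneg (hΔS i) (hΔB i))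
  have hlevel {w D : ℝ} {y z : ℝ} (hw : 1 / (T : ℝ) < w)
      (hD : D ≤ (potential R.seller (index w) - potential R'.seller (index w)) +
        (potential R.buyer (index w) - potential R'.buyer (index w)))
      (hyz : y ≤ 16 * fraction (index w) * D ∧ z ≤ rate (index w) * D) :
      y ≤ ∑ i ∈ Finset.range (levels T), 16 * fraction i *
        ((potential R.seller i - potential R'.seller i) +
          (potential R.buyer i - potential R'.buyer i)) ∧
      z ≤ 2 * (1 / T) + ∑ i ∈ Finset.range (levels T), rate i *
        ((potential R.seller i - potential R'.seller i) +
          (potential R.buyer i - potential R'.buyer i)) := by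
    -- The round is charged to its own level; the terms of all other levels are nonnegative.
    have hmem := Finset.mem_range.2 (index_lt_levels hT hw)
    have h4 := Finset.single_le_sum (fun i _ => hterm1 i) hmem
    have h5 := Finset.single_le_sum (fun i _ => hterm2 i) hmem
    have h6 := mul_le_mul_of_nonneg_left hD
      (by have := fraction_pos (index w); positivity : 0 ≤ 16 * fraction (index w))
    have h7 := mul_le_mul_of_nonneg_left hD (rate_pos (index w)).le
    exact ⟨hyz.1.trans (h6.trans h4), by linarith [hyz.2]⟩
  rcases le_or_gt (max (width R.seller x) (width R.buyer x)) (1 / (T : ℝ)) with hle | hgt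
  · obtain ⟨hp, hq⟩ := h1 hle
    have h4 := round_le_of_narrow hS hB hle hp hq
    have h5 := Finset.sum_nonneg (s := Finset.range (levels T)) fun i _ => hterm1 i
    have h6 := Finset.sum_nonneg (s := Finset.range (levels T)) fun i _ => hterm2 i
    constructor <;> linarith [h4.1, h4.2]
  · rcases le_or_gt (width R.buyer x) (width R.seller x) with hdom | hdom
    · obtain ⟨hp, hq, hq'⟩ := h2 hgt hdom
      rw [max_eq_left hdom] at hgt
      refine hlevel hgt ?_ (round_le_of_seller_dominates hd hS hB hx (hT0.trans hgt) hdom hp hq hq'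
        rfl)
      rw [← hR']
      linarith [hΔB (index (width R.seller x))]
    · obtain ⟨hq, hp, hp'⟩ := h3 hgt hdom
      rw [max_eq_right hdom.le] at hgt
      have key := round_le_of_seller_dominates (R := ⟨R.buyer, R.seller⟩) (s := b) (b := s)
        (x := -x) (p := -q) (q := -p) hd hB hS (by simpa [unitBall] using hx)
        (by rw [width_neg]; exact hT0.trans hgt) (by rw [width_neg, width_neg]; exact hdom.le)
        (by rw [width_neg]; exact isUnbalancedSellerPrice_neg_iff.2 hq)
        (fun hdis => by
          rw [lo_neg, hp fun h' => hdis ?_]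
          exact disjoint_proj_neg_iff.2 h'.symm)
        (fun hdis => by
          rw [lo_neg, hp' ?_, max_neg_neg]
          exact (disjoint_proj_neg_iff.1 hdis).symm) rfl
      rw [roundLoss_neg, roundRegret_neg, tradeBit_neg, Regions.update_swap, width_neg, ← hR']
        at key
      exact hlevel hgt (by linarith [hΔS (index (width R.buyer x))]) key

end Round

/-! ### The algorithm -/

open Classical in
/-- Prices that follow the pricing rule, if there are any. -/
noncomputable def rulePrices (T : ℕ) (R : Regions d) (x : Vec d) : ℝ × ℝ :=
  -- The choice depends only on the regions and the context. The default is never posted in a run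
  -- with `T ≥ 3` and hidden vectors in the unit ball.
  if h : ∃ pq : ℝ × ℝ, PostsUnbalancedSafe T R x pq.1 pq.2 then h.choose else 0

/-- The confidence regions, computed from the information held by the learner. -/
noncomputable def historyRegions (T : ℕ) : List (Vec d × Bool) → Regions d
  | [] => ⟨unitBall d, unitBall d⟩
  | e :: l => (historyRegions T l).update e.1 (rulePrices T (historyRegions T l) e.1).1
      (rulePrices T (historyRegions T l) e.1).2 e.2

/-- The algorithm that follows the pricing rule. -/
noncomputable def unbalancedSafe (d T : ℕ) : OneBitAlgorithm d := fun l x =>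
  rulePrices T (historyRegions T l) x

/-- `regions` refers to the algorithm, so the algorithm cannot be defined from it; the regions
rebuilt from the history agree with it. -/
theorem regions_unbalancedSafe (T : ℕ) (s b : Vec d) (x : ℕ → Vec d) (t : ℕ) :
    regions (unbalancedSafe d T) s b x t =
      historyRegions T (history (unbalancedSafe d T) s b x t) := by
  induction t with
  | zero => rfl
  | succ t ih =>
    rw [regions, ih]
    rfl

theorem exists_postsUnbalancedSafe {T : ℕ} (hT : 3 ≤ T) {R : Regions d} {s b : Vec d}
    (hS : IsConfidenceRegion R.seller s) (hB : IsConfidenceRegion R.buyer b) (x : Vec d) :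
    ∃ pq : ℝ × ℝ, PostsUnbalancedSafe T R x pq.1 pq.2 := by
  have hT0 : (0 : ℝ) < 1 / T := by positivity
  -- Caps need a nonzero direction; a zero context has width zero and falls under the narrow case.
  have hx {K : Set (Vec d)} {v : Vec d} (hK : IsConfidenceRegion K v)
      (hw : 1 / (T : ℝ) < width K x) : x ≠ 0 := by
    rintro rfl
    obtain ⟨u, -, hu⟩ := hK.exists_eq_hi 0
    obtain ⟨u', -, hu'⟩ := hK.exists_eq_lo 0
    rw [inner_zero_right] at hu hu'
    rw [width, ← hu, ← hu'] at hw
    linarith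
  rcases le_or_gt (max (width R.seller x) (width R.buyer x)) (1 / (T : ℝ)) with hle | hgt
  · exact ⟨(hi R.seller x, max (hi R.seller x) (lo R.buyer x)), fun _ => ⟨rfl, rfl⟩,
      fun h => absurd hle (not_le.2 h), fun h => absurd hle (not_le.2 h)⟩
  · rcases le_or_gt (width R.buyer x) (width R.seller x) with hdom | hdom
    · obtain ⟨p, hp⟩ := exists_isUnbalancedSellerPrice hS
        (hx hS (by rwa [max_eq_left hdom] at hgt)) (index (width R.seller x))
      by_cases hdis : Disjoint (proj R.seller x) (proj R.buyer x)
      · exact ⟨(p, max p (lo R.buyer x)), fun h => absurd h (not_le.2 hgt),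
          fun _ _ => ⟨hp, fun h => absurd hdis h, fun _ => rfl⟩,
          fun _ h => absurd hdom (not_le.2 h)⟩
      · exact ⟨(p, lo R.buyer x), fun h => absurd h (not_le.2 hgt),
          fun _ _ => ⟨hp, fun _ => rfl, fun h => absurd h hdis⟩,
          fun _ h => absurd hdom (not_le.2 h)⟩
    · obtain ⟨q', hq'⟩ := exists_isUnbalancedSellerPrice hB
        (neg_ne_zero.2 (hx hB (by rwa [max_eq_right hdom.le] at hgt))) (index (width R.buyer x))
      have hq : IsUnbalancedBuyerPrice R.buyer x (index (width R.buyer x)) (-q') :=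
        isUnbalancedSellerPrice_neg_iff.1 (by rwa [neg_neg])
      by_cases hdis : Disjoint (proj R.seller x) (proj R.buyer x)
      · exact ⟨(min (-q') (hi R.seller x), -q'), fun h => absurd h (not_le.2 hgt),
          fun _ h => absurd h (not_le.2 hdom),
          fun _ _ => ⟨hq, fun h => absurd hdis h, fun _ => rfl⟩⟩
      · exact ⟨(hi R.seller x, -q'), fun h => absurd h (not_le.2 hgt),
          fun _ h => absurd h (not_le.2 hdom),
          fun _ _ => ⟨hq, fun _ => rfl, fun h => absurd h hdis⟩⟩

theorem postsUnbalancedSafe_unbalancedSafe {T : ℕ} (hT : 3 ≤ T) {s b : Vec d} {x : ℕ → Vec d}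
    {t : ℕ} (hS : IsConfidenceRegion (regions (unbalancedSafe d T) s b x t).seller s)
    (hB : IsConfidenceRegion (regions (unbalancedSafe d T) s b x t).buyer b) :
    PostsUnbalancedSafe T (regions (unbalancedSafe d T) s b x t) (x t)
      (sellerPrice (unbalancedSafe d T) s b x t) (buyerPrice (unbalancedSafe d T) s b x t) := by
  have h := exists_postsUnbalancedSafe hT hS hB (x t)
  have hprices : unbalancedSafe d T (history (unbalancedSafe d T) s b x t) (x t) =
      rulePrices T (regions (unbalancedSafe d T) s b x t) (x t) := by
    rw [regions_unbalancedSafe]; rfl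
  rw [sellerPrice, buyerPrice, hprices, rulePrices, dif_pos h]
  exact h.choose_spec

theorem isConfidenceRegion_regions (A : OneBitAlgorithm d) {s b : Vec d} (x : ℕ → Vec d)
    (hs : s ∈ unitBall d) (hb : b ∈ unitBall d) (t : ℕ) :
    IsConfidenceRegion (regions A s b x t).seller s ∧
      IsConfidenceRegion (regions A s b x t).buyer b := by
  induction t with
  | zero => exact ⟨isConfidenceRegion_unitBall hs, isConfidenceRegion_unitBall hb⟩
  | succ t ih => exact ⟨ih.1.update_seller ih.2 _ _ _, ih.1.update_buyer ih.2 _ _ _⟩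

/-! ### Summing up -/

theorem sum_half_pow_le (n : ℕ) : ∑ i ∈ Finset.range n, (1 / 2 : ℝ) ^ i ≤ 2 :=
  sum_geometric_two_le n

theorem half_le_log {d : ℕ} (hd : 1 ≤ d) : (1 / 2 : ℝ) ≤ Real.log (d + 1) := by
  have hd' : (1 : ℝ) ≤ d := by exact_mod_cast hd
  have := Real.log_le_log (by norm_num) (by linarith : (2 : ℝ) ≤ d + 1)
  linarith [Real.log_two_gt_d9]

/-- The two summands give `272 * D` and `1632 ≤ 3264 * D`, each times `(1 / 2) ^ i`. -/
theorem fraction_mul_level_le {D : ℝ} (hD : 1 / 2 ≤ D) (i : ℕ) :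
    16 * fraction i * (D + 6 * 2 ^ i) ≤ 3600 * D * (1 / 2) ^ i := by
  have h1 := fraction_mul_le i
  have hf := fraction_pos i
  have h2 : (1 : ℝ) ≤ 2 ^ i := one_le_pow₀ (by norm_num)
  have h3 : fraction i ≤ 17 * (1 / 2) ^ i := by nlinarith
  have h4 : (0 : ℝ) < (1 / 2) ^ i := by positivity
  nlinarith

/-- The constant `48` comes from rejections: `8 * 2 ^ (-i)` against `6 * 2 ^ i`. Summed over the
levels it yields the `log log T` term. -/
theorem rate_mul_level_le {D : ℝ} (hD : 1 / 2 ≤ D) (i : ℕ) :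
    rate i * (D + 6 * 2 ^ i) ≤ 3608 * D * (1 / 2) ^ i + 48 := by
  have h1 := fraction_mul_level_le hD i
  have hl : (1 / 2 : ℝ) ≤ Real.log 2 := by linarith [Real.log_two_gt_d9]
  have h2 : 4 / (2 ^ i * Real.log 2) ≤ 8 * (1 / 2 : ℝ) ^ i := by
    rw [div_le_iff₀ (by positivity), one_div, inv_pow]
    field_simp
    linarith
  have h3 : (1 / 2 : ℝ) ^ i * 2 ^ i = 1 := by rw [← mul_pow]; norm_num
  have h4 := mul_le_mul_of_nonneg_right h2 (by positivity : 0 ≤ D + 6 * (2 : ℝ) ^ i)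
  have h5 : 8 * (1 / 2 : ℝ) ^ i * (D + 6 * 2 ^ i) = 8 * D * (1 / 2) ^ i + 48 := by
    linear_combination 48 * h3
  rw [rate, add_mul]
  linarith

/-- Weighted decreases of the potentials telescope over the rounds. -/
theorem sum_potential_le (A : OneBitAlgorithm d) {s b : Vec d} (x : ℕ → Vec d) (hd : 1 ≤ d)
    (hs : s ∈ unitBall d) (hb : b ∈ unitBall d) (T N : ℕ) {c : ℕ → ℝ} (hc : ∀ i, 0 ≤ c i) :
    ∑ t ∈ Finset.range T, ∑ i ∈ Finset.range N, c i *
      ((potential (regions A s b x t).seller i - potential (regions A s b x (t + 1)).seller i) +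
        (potential (regions A s b x t).buyer i - potential (regions A s b x (t + 1)).buyer i)) ≤
      2 * d * ∑ i ∈ Finset.range N, c i * (Real.log (d + 1) + 6 * 2 ^ i) := by
  have hreg := isConfidenceRegion_regions A x hs hb
  rw [Finset.sum_comm, Finset.mul_sum]
  refine Finset.sum_le_sum fun i _ => ?_
  rw [← Finset.mul_sum, Finset.sum_add_distrib,
    Finset.sum_range_sub' (fun t => potential (regions A s b x t).seller i),
    Finset.sum_range_sub' (fun t => potential (regions A s b x t).buyer i)]
  have h1 := potential_sub_le (hreg 0).1 (hreg T).1 hd i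
  have h2 := potential_sub_le (hreg 0).2 (hreg T).2 hd i
  have := mul_le_mul_of_nonneg_left (add_le_add h1 h2) (hc i)
  linarith

end BilateralTrade

open BilateralTrade in
theorem theorem5p5 :
    ∃ C : ℝ, 0 < C ∧ ∀ d T : ℕ, 1 ≤ d → 3 ≤ T →
      ∃ A : BilateralTrade.OneBitAlgorithm d,
        ∀ (s b : BilateralTrade.Vec d) (x : ℕ → BilateralTrade.Vec d),
          s ∈ BilateralTrade.unitBall d → b ∈ BilateralTrade.unitBall d →
          (∀ t, x t ∈ BilateralTrade.unitBall d) →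
            (∀ t < T, BilateralTrade.PostsUnbalancedSafe T (BilateralTrade.regions A s b x t) (x t)
              (BilateralTrade.sellerPrice A s b x t) (BilateralTrade.buyerPrice A s b x t)) ∧
            BilateralTrade.regret A T s b x
              ≤ C * (d * Real.log (Real.log T) + d * Real.log (d + 1)) ∧
            BilateralTrade.negativeProfit A T s b x ≤ C * (d * Real.log (d + 1)) := by
  refine ⟨20000, by norm_num, fun d T hd hT => ⟨unbalancedSafe d T, fun s b x hs hb hx => ?_⟩⟩
  have hreg := isConfidenceRegion_regions (unbalancedSafe d T) x hs hb
  have hposts (t : ℕ) := postsUnbalancedSafe_unbalancedSafe hT (hreg t).1 (hreg t).2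
  have hround (t : ℕ) := (hposts t).round_le hT hd (hreg t).1 (hreg t).2 (hx t)
    (R' := regions (unbalancedSafe d T) s b x (t + 1)) rfl
  have hd' : (1 : ℝ) ≤ d := by exact_mod_cast hd
  have hD := half_le_log hd
  set D := Real.log ((d : ℝ) + 1)
  have hgeo := sum_half_pow_le (levels T)
  have hT0 : (T : ℝ) ≠ 0 := by positivity
  refine ⟨fun t _ => hposts t, ?_, ?_⟩
  · have h1 := Finset.sum_le_sum fun t (_ : t ∈ Finset.range T) => (hround t).2
    rw [Finset.sum_add_distrib, Finset.sum_const, Finset.card_range, nsmul_eq_mul,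
      show (T : ℝ) * (2 * (1 / T)) = 2 by field_simp] at h1
    have h2 := sum_potential_le (unbalancedSafe d T) x hd hs hb T (levels T)
      fun i => (rate_pos i).le
    have h3 := Finset.sum_le_sum fun i (_ : i ∈ Finset.range (levels T)) => rate_mul_level_le hD i
    rw [Finset.sum_add_distrib, ← Finset.mul_sum, Finset.sum_const, Finset.card_range,
      nsmul_eq_mul] at h3
    have h4 := mul_le_mul_of_nonneg_left hgeo (by linarith : 0 ≤ 3608 * D)
    have h5 := levels_le hT
    have h6 : ∑ i ∈ Finset.range (levels T), rate i * (D + 6 * 2 ^ i) ≤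
        7600 * D + 96 * Real.log (Real.log T) := by linarith
    have h7 := mul_le_mul_of_nonneg_left h6 (by linarith : 0 ≤ 2 * (d : ℝ))
    -- Absorbs the additive `2`, which is `T` times the narrow-round bound `2 / T`.
    have h8 : 1 / 2 ≤ d * D := by nlinarith
    have h9 : 0 ≤ d * Real.log (Real.log T) := mul_nonneg (by linarith) (log_log_pos hT).le
    rw [regret, ← Finset.sum_sub_distrib]
    exact (h1.trans (add_le_add_right (h2.trans h7) 2)).trans (by linarith)
  · have h1 := Finset.sum_le_sum fun t (_ : t ∈ Finset.range T) => (hround t).1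
    have h2 := sum_potential_le (unbalancedSafe d T) x hd hs hb T (levels T)
      (c := fun i => 16 * fraction i) fun i => by have := fraction_pos i; positivity
    have h3 := Finset.sum_le_sum fun i (_ : i ∈ Finset.range (levels T)) =>
      fraction_mul_level_le hD i
    rw [← Finset.mul_sum] at h3
    have h4 := mul_le_mul_of_nonneg_left hgeo (by linarith : 0 ≤ 3600 * D)
    have h6 : ∑ i ∈ Finset.range (levels T), 16 * fraction i * (D + 6 * 2 ^ i) ≤ 7200 * D := by
      linarith
    have h7 := mul_le_mul_of_nonneg_left h6 (by linarith : 0 ≤ 2 * (d : ℝ))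
    have h8 : 1 / 2 ≤ d * D := by nlinarith
    exact h1.trans (h2.trans (h7.trans (by linarith)))
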